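/- Let $\mathcal Z$ be a complex Hilbert space, let $A:D(A)\subset\mathcal Z\to\mathcal Z$ be a self-adjoint, negative semi-definite operator ($\langle Az,z\rangle\le 0$ for all $z\in D(A)$), and let $0\ne b\in D((-A)^{1/2})$, where $(-A)^{1/2}$ is the non-negative self-adjoint square root of $-A$. Assume that $\sigma(A)$ is non-empty, has no finite accumulation point, and consists of eigenvalues of finite algebraic multiplicity. Let $B:\mathbb C\to\mathcal Z$, $Bu=ub$, and $C=B^*$, i.e. $Cx=\langle x,b\rangle$. The invariant zeros of the system $\Sigma(A,B,B^*)$ are the $\mu\in\mathbb C$ for which there are a non-zero $x\in D(A)$ and a $u\in\mathbb C$ with $(\mu I-A)x-Bu=0$ and $B^*x=0$. Assume that the system is minimal, i.e. that no invariant zero lies in $\sigma(A)$. Then the set of invariant zeros is countable, and the invariant zeros become arbitrarily close to eigenvalues of $A$: if $(\mu_n)_{n\in\mathbb N}$ is any sequence of invariant zeros in which each value occurs only finitely often (in particular, any enumeration of the invariant zeros, if there are infinitely many of them), then for every $\varepsilon>0$ there is $N\in\mathbb N$ such that for every $n\ge N$ there is an eigenvalue $\lambda$ of $A$ with $|\mu_n-\lambda|<\varepsilon$.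 -/

import Mathlib

namespace UnboundedOp

variable {Z : Type*} [NormedAddCommGroup Z] [InnerProductSpace ℂ Z]

/-- The resolvent set `ρ(A)` of a partially defined operator `A : D(A) ⊆ Z → Z`: all `s ∈ ℂ` for
which `s I - A : D(A) → Z` has an everywhere defined bounded two-sided inverse `R`. -/
def resolventSet (A : Z →ₗ.[ℂ] Z) : Set ℂ :=
  {s | ∃ R : Z →L[ℂ] Z,
    (∀ z : Z, ∃ h : R z ∈ A.domain, s • R z - A ⟨R z, h⟩ = z) ∧
    ∀ x : A.domain, R (s • (x : Z) - A x) = x}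

/-- The spectrum `σ(A) = ℂ \ ρ(A)`. -/
def spectrum (A : Z →ₗ.[ℂ] Z) : Set ℂ := (resolventSet A)ᶜ

/-- `s` is an eigenvalue of `A`. -/
def IsEigenvalue (A : Z →ₗ.[ℂ] Z) (s : ℂ) : Prop :=
  ∃ x : A.domain, (x : Z) ≠ 0 ∧ A x = s • (x : Z)

/-- `ker (s I - A) ^ k`, where the powers have their natural domains:
`x ∈ ker (s I - A) ^ (k + 1)` iff `x ∈ D(A)` and `s x - A x ∈ ker (s I - A) ^ k`. -/
def kerPow (A : Z →ₗ.[ℂ] Z) (s : ℂ) : ℕ → Submodule ℂ Z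
  | 0 => ⊥
  | k + 1 => ((kerPow A s k).comap (s • A.domain.subtype - A.toFun)).map A.domain.subtype

/-- The generalized eigenspace of `A` at `s`; its dimension is the algebraic multiplicity of an
isolated eigenvalue `s` of a self-adjoint operator `A`. -/
def generalizedEigenspace (A : Z →ₗ.[ℂ] Z) (s : ℂ) : Submodule ℂ Z := ⨆ k, kerPow A s k

/-- `σ(A)` is non-empty, has no finite accumulation point, and consists of eigenvalues of finite
algebraic multiplicity. -/
structure HasDiscreteSpectrum (A : Z →ₗ.[ℂ] Z) : Prop where
  nonempty : (spectrum A).Nonempty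
  not_accPt : ∀ s : ℂ, ¬ AccPt s (Filter.principal (spectrum A))
  isEigenvalue : ∀ s ∈ spectrum A, IsEigenvalue A s
  finite_mult : ∀ s ∈ spectrum A, FiniteDimensional ℂ (generalizedEigenspace A s)

/-- `⟨A x, x⟩ ≤ 0` on `D(A)` (for self-adjoint `A`, where `⟨A x, x⟩` is real). -/
def IsNegSemidef (A : Z →ₗ.[ℂ] Z) : Prop :=
  ∀ x : A.domain, (inner ℂ (A x) (x : Z)).re ≤ 0

/-- `⟨A x, x⟩ ≥ 0` on `D(A)` (for self-adjoint `A`, where `⟨A x, x⟩` is real). -/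
def IsPosSemidef (A : Z →ₗ.[ℂ] Z) : Prop :=
  ∀ x : A.domain, 0 ≤ (inner ℂ (A x) (x : Z)).re

/-- `S` is the square root of the non-negative self-adjoint operator `T`, i.e. the (unique)
non-negative self-adjoint operator with `S ∘ S = T`, where `S ∘ S` has its natural domain
`{x ∈ D(S) | S x ∈ D(S)}`. -/
structure IsSqrt [CompleteSpace Z] (T S : Z →ₗ.[ℂ] Z) : Prop where
  isSelfAdjoint : IsSelfAdjoint S
  isPosSemidef : IsPosSemidef S
  sq_eq : ∀ x y : Z, (x, y) ∈ T.graph ↔ ∃ w : Z, (x, w) ∈ S.graph ∧ (w, y) ∈ S.graph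

/-- The domain of `T ^ (1/2)` for a non-negative self-adjoint operator `T`. -/
def sqrtDomain [CompleteSpace Z] (T : Z →ₗ.[ℂ] Z) : Set Z :=
  {x | ∃ S : Z →ₗ.[ℂ] Z, IsSqrt T S ∧ x ∈ S.domain}

/-- The invariant zeros of the system `x' = A x + B u`, `y = C x + D u` with scalar input and
output: all `s` such that `(s I - A) x - B u = 0`, `C x + D u = 0` for some scalar `u` and some
non-zero `x ∈ D(A)`. -/
def invariantZeros (A : Z →ₗ.[ℂ] Z) (B : ℂ →L[ℂ] Z) (C : Z →L[ℂ] ℂ) (D : ℂ) : Set ℂ :=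
  {s | ∃ (x : A.domain) (u : ℂ), (x : Z) ≠ 0 ∧
    (s • (x : Z) - A x) - B u = 0 ∧ C (x : Z) + D * u = 0}

/-- A system is minimal if no invariant zero lies in the spectrum of `A`. -/
def IsMinimal (A : Z →ₗ.[ℂ] Z) (B : ℂ →L[ℂ] Z) (C : Z →L[ℂ] ℂ) (D : ℂ) : Prop :=
  invariantZeros A B C D ∩ spectrum A = ∅

/-- The input operator `B u = u b`. -/
noncomputable def inputOp (b : Z) : ℂ →L[ℂ] Z := ContinuousLinearMap.toSpanSingleton ℂ b

/-- A system `(A, B, C)` is collocated self-adjoint if `A` is self-adjoint and `C = B*`. -/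
structure IsCollocatedSelfAdjoint [CompleteSpace Z] (A : Z →ₗ.[ℂ] Z) (B : ℂ →L[ℂ] Z)
    (C : Z →L[ℂ] ℂ) : Prop where
  isSelfAdjoint : IsSelfAdjoint A
  collocated : C = ContinuousLinearMap.adjoint B

end UnboundedOp

open scoped ENNReal NNReal

namespace UnboundedOp

variable {Z : Type*} [NormedAddCommGroup Z] [InnerProductSpace ℂ Z]

/-! Minimality puts every zero s in the resolvent set, so after scaling it comes with x = (sI-A)⁻¹b
orthogonal to b. Self-adjointness makes s real and makes the x of distinct zeros orthogonal. Since
(sI-A)⁻¹b depends continuously on s and orthogonal nonzero vectors are never relatively close, zeros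
are isolated in the resolvent set (`exists_ball_subsingleton`): countable, and finite on compact
subsets. It remains to bound the zeros at distance ≥ ε from the spectrum. With S = (-A)^{1/2}, y =
Sb and w = Sx satisfy (sI-A)w = y and ⟪y, w⟫ = ‖b‖² (`exists_sqrt_vector`), so ‖w‖ stays away from
0. But at such real s resolvents have norm ≤ 1/ε, hence tend to 0 strongly as |s| → ∞
(`exists_norm_le_of_le_norm`). -/

/-- The resolvent identity, for inverses of `s I - A` and `t I - A` given as in `resolventSet`. -/
theorem resolvent_identity {A : Z →ₗ.[ℂ] Z} {s t : ℂ} {R R' : Z →L[ℂ] Z}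
    (hR : ∀ x : A.domain, R (s • (x : Z) - A x) = x)
    (hR' : ∀ z : Z, ∃ h : R' z ∈ A.domain, t • R' z - A ⟨R' z, h⟩ = z) (z : Z) :
    R' z = (s - t) • R (R' z) + R z := by
  obtain ⟨h, hz⟩ := hR' z
  have h1 := hR ⟨R' z, h⟩
  have h2 : s • R' z - A ⟨R' z, h⟩ = (s - t) • R' z + z := by
    nth_rewrite 4 [← hz]
    module
  rw [h2, map_add, map_smul] at h1
  exact h1.symm

/-- `s I - A` is injective for `s` in the resolvent set. -/
theorem eq_zero_of_mem_resolventSet {A : Z →ₗ.[ℂ] Z} {s : ℂ} (hs : s ∈ resolventSet A)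
    {x : A.domain} (hx : s • (x : Z) - A x = 0) : (x : Z) = 0 := by
  obtain ⟨R, -, hR⟩ := hs
  rw [← hR x, hx, map_zero]

/-- A nonzero spectral value `ν` of the resolvent at `s` comes from the spectral value `s - ν⁻¹`
of the operator. -/
theorem sub_inv_mem_spectrum {A : Z →ₗ.[ℂ] Z} {s : ℂ} {R : Z →L[ℂ] Z}
    (hR₁ : ∀ z : Z, ∃ h : R z ∈ A.domain, s • R z - A ⟨R z, h⟩ = z)
    (hR₂ : ∀ x : A.domain, R (s • (x : Z) - A x) = x) {ν : ℂ} (hν : ν ≠ 0)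
    (h : ν ∈ _root_.spectrum ℂ R) : s - ν⁻¹ ∈ spectrum A := by
  rintro ⟨R', h₁, h₂⟩
  refine h ?_
  have e₁ := resolvent_identity hR₂ h₁
  have e₂ := resolvent_identity h₂ hR₁
  -- With t = s - ν⁻¹, ν - R = ν(tI-A)R, whose inverse is ν⁻¹(sI-A)R' = ν⁻¹(1 + ν⁻¹R').
  refine isUnit_iff_exists.2 ⟨ν⁻¹ • (1 + ν⁻¹ • R'), ?_, ?_⟩
  · ext z
    have := e₁ z
    simp only [sub_sub_cancel] at this
    rw [Algebra.algebraMap_eq_smul_one]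
    change ν • (ν⁻¹ • (z + ν⁻¹ • R' z)) - R (ν⁻¹ • (z + ν⁻¹ • R' z)) = z
    simp only [map_smul, map_add]
    have h3 : ν⁻¹ • R (R' z) = R' z - R z := by rw [eq_sub_iff_add_eq, ← this]
    rw [h3, smul_inv_smul₀ hν]
    module
  · ext z
    have := e₂ z
    simp only [sub_sub_cancel_left] at this
    rw [Algebra.algebraMap_eq_smul_one]
    change ν⁻¹ • ((ν • z - R z) + ν⁻¹ • R' (ν • z - R z)) = z
    simp only [map_smul, map_sub]
    have h3 : ν⁻¹ • R' (R z) = R' z - R z := by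
      nth_rewrite 2 [this]
      module
    rw [smul_sub ν⁻¹, h3, inv_smul_smul₀ hν, show ν • z - R z + (R' z - (R' z - R z)) = ν • z by
      module, inv_smul_smul₀ hν]

/-- `b` is the image under `s I - A` of a nonzero vector orthogonal to `b`. For `s` in the
resolvent set this says that `s` is an invariant zero of the collocated system given by `b`. -/
def IsNormalizedZero (A : Z →ₗ.[ℂ] Z) (b : Z) (s : ℂ) (x : A.domain) : Prop :=
  (x : Z) ≠ 0 ∧ s • (x : Z) - A x = b ∧ inner ℂ b (x : Z) = 0

section Complete

variable [CompleteSpace Z] {A : Z →ₗ.[ℂ] Z}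

theorem inner_apply_eq (hA : IsSelfAdjoint A) (x y : A.domain) :
    inner ℂ (A x) (y : Z) = inner ℂ (x : Z) (A y) := by
  have h := LinearPMap.adjoint_isFormalAdjoint hA.dense_domain
  rw [LinearPMap.isSelfAdjoint_def.1 hA] at h
  exact h x y

/-! ### Resolvent estimates at real points -/

/-- For real `s`, `s I - A` is bounded below by the distance of `s` to the spectrum. -/
theorem mul_norm_le_of_forall_spectrum (hA : IsSelfAdjoint A) {s : ℂ}
    (hs : starRingEnd ℂ s = s) {ε : ℝ} (hε : 0 < ε) (hd : ∀ l ∈ spectrum A, ε ≤ ‖s - l‖)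
    (x : A.domain) : ε * ‖(x : Z)‖ ≤ ‖s • (x : Z) - A x‖ := by
  have hsρ : s ∈ resolventSet A := by
    by_contra h
    have := hd s h
    rw [sub_self, norm_zero] at this
    exact absurd this (not_le.2 hε)
  obtain ⟨R, h₁, h₂⟩ := hsρ
  have hsa : IsSelfAdjoint R := by
    rw [ContinuousLinearMap.isSelfAdjoint_iff_isSymmetric]
    intro u v
    obtain ⟨hu, hu'⟩ := h₁ u
    obtain ⟨hv, hv'⟩ := h₁ v
    have key := inner_apply_eq hA ⟨R u, hu⟩ ⟨R v, hv⟩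
    change inner ℂ (R u) v = inner ℂ u (R v)
    rw [← hu', ← hv', inner_sub_left, inner_sub_right, inner_smul_left, inner_smul_right, hs,
      hu', hv']
    exact congrArg _ key.symm
  -- The norm of a self-adjoint operator is its spectral radius, and each nonzero ν in the spectrum
  -- of R is 1/(s-l) with l in that of A.
  have hnorm : ‖R‖ ≤ ε⁻¹ := by
    obtain ⟨c, hc⟩ : ∃ c : ℝ≥0, (c : ℝ) = ε⁻¹ := ⟨_, Real.coe_toNNReal _ (inv_pos.2 hε).le⟩
    have hr : spectralRadius ℂ R ≤ c := by
      refine iSup₂_le fun ν hν => ?_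
      rw [ENNReal.coe_le_coe, ← NNReal.coe_le_coe, coe_nnnorm, hc]
      rcases eq_or_ne ν 0 with rfl | h0
      · simpa using hε.le
      have := hd _ (sub_inv_mem_spectrum h₁ h₂ h0 hν)
      rw [sub_sub_cancel, norm_inv] at this
      exact (le_inv_comm₀ hε (norm_pos_iff.2 h0)).1 this
    rw [hsa.spectralRadius_eq_nnnorm, ENNReal.coe_le_coe, ← NNReal.coe_le_coe, coe_nnnorm,
      hc] at hr
    exact hr
  have h3 := R.le_of_opNorm_le hnorm (s • (x : Z) - A x)
  rw [h₂ x] at h3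
  calc ε * ‖(x : Z)‖ ≤ ε * (ε⁻¹ * ‖s • (x : Z) - A x‖) := by gcongr
    _ = _ := mul_inv_cancel_left₀ hε.ne' _

/-- Resolvents at points far from the spectrum tend to zero strongly at infinity. -/
theorem exists_norm_le_of_le_norm (hA : IsSelfAdjoint A) (y : Z) {ε δ : ℝ} (hε : 0 < ε)
    (hδ : 0 < δ) : ∃ M : ℝ, ∀ (s : ℂ) (w : A.domain), starRingEnd ℂ s = s →
      (∀ l ∈ spectrum A, ε ≤ ‖s - l‖) → s • (w : Z) - A w = y → δ ≤ ‖(w : Z)‖ → ‖s‖ ≤ M := by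
  obtain ⟨y', hy', hd⟩ := Metric.mem_closure_iff.1 (hA.dense_domain y) (ε * (δ / 2)) (by positivity)
  rw [dist_eq_norm] at hd
  set v : A.domain := ⟨y', hy'⟩
  refine ⟨(‖y'‖ + ‖A v‖ / ε) / (δ / 2), fun s w hs hσ hw hδw => ?_⟩
  -- (sI-A)(sw-v) = s(y-y') + Av: the first term costs only |s|δ/2, half of the lower bound |s|δ on
  -- ‖sw‖.
  have h1 := mul_norm_le_of_forall_spectrum hA hs hε hσ (s • w - v)
  have h2 : s • ((s • w - v : A.domain) : Z) - A (s • w - v) = s • (y - y') + A v := by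
    rw [← hw, A.map_sub, A.map_smul]
    simp only [Submodule.coe_sub, Submodule.coe_smul, v]
    module
  rw [h2] at h1
  have h3 : ‖s • (y - y') + A v‖ ≤ ‖s‖ * (ε * (δ / 2)) + ‖A v‖ := by
    refine (norm_add_le _ _).trans ?_
    rw [norm_smul]
    gcongr
  have h4 : ‖s‖ * ‖(w : Z)‖ ≤ ‖((s • w - v : A.domain) : Z)‖ + ‖y'‖ := by
    rw [← norm_smul]
    have : s • (w : Z) = ((s • w - v : A.domain) : Z) + y' := by simp [v]
    rw [this]
    exact norm_add_le _ _
  have h5 : ‖((s • w - v : A.domain) : Z)‖ ≤ ‖s‖ * (δ / 2) + ‖A v‖ / ε := by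
    rw [← mul_le_mul_iff_right₀ hε]
    refine (h1.trans h3).trans_eq ?_
    field_simp
  rw [le_div_iff₀ (by positivity)]
  have h6 : ‖s‖ * δ ≤ ‖s‖ * ‖(w : Z)‖ := by gcongr
  linarith

/-! ### Reality, orthogonality and isolation of zeros -/

/-- Pairing (sI-A)x = b with x on either side gives 0, and ⟪Ax, x⟫ = ⟪x, Ax⟫. -/
theorem IsNormalizedZero.conj_eq (hA : IsSelfAdjoint A) {b : Z} {s : ℂ} {x : A.domain}
    (h : IsNormalizedZero A b s x) : starRingEnd ℂ s = s := by
  obtain ⟨h0, h1, h2⟩ := h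
  have h3 : inner ℂ (x : Z) b = 0 := inner_eq_zero_symm.1 h2
  rw [← h1, inner_sub_left, inner_smul_left] at h2
  rw [← h1, inner_sub_right, inner_smul_right] at h3
  have h4 := inner_apply_eq hA x x
  have h5 : (inner ℂ (x : Z) (x : Z) : ℂ) ≠ 0 := inner_self_ne_zero.2 h0
  refine mul_right_cancel₀ h5 ?_
  linear_combination h2 - h3 + h4

theorem IsNormalizedZero.inner_eq_zero (hA : IsSelfAdjoint A) {b : Z} {s t : ℂ} {x y : A.domain}
    (hx : IsNormalizedZero A b s x) (hy : IsNormalizedZero A b t y) (hst : s ≠ t) :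
    inner ℂ (x : Z) (y : Z) = 0 := by
  have h2 := hy.2.2
  have h3 : inner ℂ (x : Z) b = 0 := inner_eq_zero_symm.1 hx.2.2
  rw [← hx.2.1, inner_sub_left, inner_smul_left, hx.conj_eq hA] at h2
  rw [← hy.2.1, inner_sub_right, inner_smul_right] at h3
  have h4 := inner_apply_eq hA x y
  refine (mul_eq_zero.1 ?_).resolve_left (sub_ne_zero.2 hst)
  linear_combination h2 - h3 + h4

/-- Invariant zeros do not accumulate in the resolvent set. -/
theorem exists_ball_subsingleton (hA : IsSelfAdjoint A) (b : Z) {s : ℂ}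
    (hs : s ∈ resolventSet A) :
    ∃ δ > 0, {t | ∃ x, IsNormalizedZero A b t x} ∩ Metric.ball s δ |>.Subsingleton := by
  obtain ⟨R, -, h₂⟩ := hs
  -- This makes |s-t|‖R‖ ≤ 1/4, so two zeros in the ball would have ‖x-x'‖ ≤ (‖x‖+‖x'‖)/4, against
  -- Pythagoras.
  set δ : ℝ := (4 * (‖R‖ + 1))⁻¹
  have hδ : 0 < δ := by positivity
  have close : ∀ t ∈ Metric.ball s δ, ∀ x : A.domain, IsNormalizedZero A b t x →
      ‖(x : Z) - R b‖ ≤ ‖(x : Z)‖ / 4 := by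
    intro t ht x hx
    rw [mem_ball_iff_norm, norm_sub_rev] at ht
    have h : (x : Z) - R b = (s - t) • R x := by
      have h1 := h₂ x
      have h2 : s • (x : Z) - A x = (s - t) • (x : Z) + b := by
        rw [← hx.2.1]
        module
      rw [h2, map_add, map_smul] at h1
      rw [sub_eq_iff_eq_add, h1]
    rw [h, norm_smul]
    calc ‖s - t‖ * ‖R x‖ ≤ δ * ((‖R‖ + 1) * ‖(x : Z)‖) := by
          gcongr
          exact R.le_of_opNorm_le (by linarith) _
      _ = ‖(x : Z)‖ / 4 := by
          simp only [δ]
          field_simp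
  refine ⟨δ, hδ, ?_⟩
  rintro t ⟨⟨x, hx⟩, ht⟩ t' ⟨⟨x', hx'⟩, ht'⟩
  by_contra hne
  have ho := hx.inner_eq_zero hA hx' hne
  have hc := close t ht x hx
  have hc' := close t' ht' x' hx'
  have hn : ‖(x : Z) - x'‖ ≤ ‖(x : Z)‖ / 4 + ‖(x' : Z)‖ / 4 := by
    refine (norm_sub_le_norm_sub_add_norm_sub _ (R b) _).trans (add_le_add hc ?_)
    rwa [norm_sub_rev]
  have hp : ‖(x : Z) - x'‖ * ‖(x : Z) - x'‖ =
      ‖(x : Z)‖ * ‖(x : Z)‖ + ‖(x' : Z)‖ * ‖(x' : Z)‖ := by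
    simpa [← sub_eq_add_neg] using norm_add_sq_eq_norm_sq_add_norm_sq_of_inner_eq_zero
      (𝕜 := ℂ) (x : Z) (-(x' : Z)) (by rw [inner_neg_right, ho, neg_zero])
  have hpos := norm_pos_iff.2 hx.1
  have hpos' := norm_pos_iff.2 hx'.1
  have := mul_self_le_mul_self (norm_nonneg _) hn
  nlinarith [sq_nonneg (‖(x : Z)‖ - ‖(x' : Z)‖)]

/-! ### Zeros far from the spectrum -/

/-- If `b` lies in the domain of the square root `S` of `-A`, then `y = S b` and `w = S x` satisfy
`(s I - A) w = y` and `⟪y, w⟫ = ‖b‖ ^ 2` at each zero `s`. -/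
theorem exists_sqrt_vector {b : Z} (hdom : b ∈ sqrtDomain (-A)) :
    ∃ y : Z, ∀ (s : ℂ) (x : A.domain), IsNormalizedZero A b s x →
      ∃ w : A.domain, s • (w : Z) - A w = y ∧ inner ℂ y (w : Z) = inner ℂ b b := by
  obtain ⟨S, hS, hbS⟩ := hdom
  refine ⟨S ⟨b, hbS⟩, fun s x hx => ?_⟩
  obtain ⟨w, hxw, hwx⟩ := (hS.sq_eq x (-A x)).1 (LinearPMap.mem_graph (-A) x)
  have hyS : (b, S ⟨b, hbS⟩) ∈ S.graph := LinearPMap.mem_graph S ⟨b, hbS⟩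
  -- Both b and x lie in D(S), hence so does -Ax = b - sx; this puts w = Sx in D(A).
  have hw2 : (-A x, S ⟨b, hbS⟩ - s • w) ∈ S.graph := by
    have h := S.graph.sub_mem hyS (S.graph.smul_mem s hxw)
    have e : -A x = b - s • (x : Z) := by
      rw [← hx.2.1]
      module
    rw [e]
    simpa using h
  have hA := (hS.sq_eq w (S ⟨b, hbS⟩ - s • w)).2 ⟨_, hwx, hw2⟩
  obtain ⟨w', hw', hAw⟩ := (LinearPMap.mem_graph_iff _).1 hA
  refine ⟨w', ?_, ?_⟩
  · have e : -(A w') = S ⟨b, hbS⟩ - s • w := hAw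
    rw [sub_eq_add_neg, e]
    change (w' : Z) = w at hw'
    rw [hw']
    module
  · obtain ⟨v, hv, hv'⟩ := (LinearPMap.mem_graph_iff _).1 hwx
    have h1 := inner_apply_eq hS.isSelfAdjoint ⟨b, hbS⟩ v
    change (v : Z) = w at hv
    change (w' : Z) = w at hw'
    change S v = -A x at hv'
    rw [hv, hv'] at h1
    rw [hw', h1]
    have e : -A x = b - s • (x : Z) := by
      rw [← hx.2.1]
      module
    rw [e, inner_sub_right, inner_smul_right, hx.2.2, mul_zero, sub_zero]

/-- The invariant zeros at distance at least `ε` from the spectrum are bounded. -/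
theorem exists_norm_le_of_isNormalizedZero (hA : IsSelfAdjoint A) {b : Z} (hb : b ≠ 0)
    (hdom : b ∈ sqrtDomain (-A)) {ε : ℝ} (hε : 0 < ε) :
    ∃ M : ℝ, ∀ (s : ℂ) (x : A.domain), IsNormalizedZero A b s x →
      (∀ l ∈ spectrum A, ε ≤ ‖s - l‖) → ‖s‖ ≤ M := by
  obtain ⟨y, hy⟩ := exists_sqrt_vector hdom
  have hb' : 0 < ‖b‖ := norm_pos_iff.2 hb
  obtain ⟨M, hM⟩ := exists_norm_le_of_le_norm hA y hε
    -- Cauchy–Schwarz for ⟪y, w⟫ = ‖b‖²; the +1 covers y = 0.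
    (show 0 < ‖b‖ ^ 2 / (‖y‖ + 1) by positivity)
  refine ⟨M, fun s x hx hσ => ?_⟩
  obtain ⟨w, hw, hyw⟩ := hy s x hx
  refine hM s w (hx.conj_eq hA) hσ hw ?_
  rw [div_le_iff₀ (by positivity)]
  have h1 : ‖b‖ ^ 2 ≤ ‖y‖ * ‖(w : Z)‖ := by
    have := norm_inner_le_norm (𝕜 := ℂ) y (w : Z)
    rw [hyw, inner_self_eq_norm_sq_to_K] at this
    simpa using this
  nlinarith [norm_nonneg (w : Z)]

/-- The invariant zeros at distance at least `ε` from the spectrum are finite in number. -/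
theorem finite_isNormalizedZero (hA : IsSelfAdjoint A) {b : Z} (hb : b ≠ 0)
    (hdom : b ∈ sqrtDomain (-A)) {ε : ℝ} (hε : 0 < ε) :
    {s | (∃ x, IsNormalizedZero A b s x) ∧ ∀ l ∈ spectrum A, ε ≤ ‖s - l‖}.Finite := by
  obtain ⟨M, hM⟩ := exists_norm_le_of_isNormalizedZero hA hb hdom hε
  set K : Set ℂ := Metric.closedBall 0 M ∩ {s | ∀ l ∈ spectrum A, ε ≤ ‖s - l‖} with hK
  have hKc : IsCompact K := by
    refine (isCompact_closedBall _ _).inter_right ?_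
    simp only [Set.ofPred_forall]
    exact isClosed_biInter fun l _ => isClosed_le continuous_const (by fun_prop)
  have hKρ : ∀ s ∈ K, s ∈ resolventSet A := by
    intro s hs
    by_contra h
    have := hs.2 s h
    rw [sub_self, norm_zero] at this
    exact absurd this (not_le.2 hε)
  have hfin : ({s | ∃ x, IsNormalizedZero A b s x} ∩ K).Finite := by
    refine hKc.induction_on (p := fun U => ({s | ∃ x, IsNormalizedZero A b s x} ∩ U).Finite)
      (by simp) (fun U V hUV h => h.subset (by gcongr)) (fun U V hU hV => ?_) (fun s hs => ?_)
    · rw [Set.inter_union_distrib_left]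
      exact hU.union hV
    · obtain ⟨δ, hδ, h⟩ := exists_ball_subsingleton hA b (hKρ s hs)
      exact ⟨_, mem_nhdsWithin_of_mem_nhds (Metric.ball_mem_nhds s hδ), h.finite⟩
  refine hfin.subset ?_
  rintro s ⟨⟨x, hx⟩, hσ⟩
  exact ⟨⟨x, hx⟩, by simpa using hM s x hx hσ, hσ⟩

theorem countable_isNormalizedZero (hA : IsSelfAdjoint A) (b : Z) :
    ({s | ∃ x, IsNormalizedZero A b s x} ∩ resolventSet A).Countable := by
  set T := {s | ∃ x, IsNormalizedZero A b s x} ∩ resolventSet A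
  have : DiscreteTopology T := by
    refine discreteTopology_subtype_iff'.2 fun s hs => ?_
    obtain ⟨δ, hδ, h⟩ := exists_ball_subsingleton hA b hs.2
    refine ⟨Metric.ball s δ, Metric.isOpen_ball, Set.Subset.antisymm ?_ ?_⟩
    · rintro t ⟨ht, ht'⟩
      exact h ⟨ht'.1, ht⟩ ⟨hs.1, Metric.mem_ball_self hδ⟩
    · rintro t rfl
      exact ⟨Metric.mem_ball_self hδ, hs⟩
  exact Set.countable_coe_iff.1 (TopologicalSpace.separableSpace_iff_countable.1 inferInstance)

theorem exists_isNormalizedZero {b : Z} {C : Z →L[ℂ] ℂ}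
    (hcol : IsCollocatedSelfAdjoint A (inputOp b) C)
    {s : ℂ} (hs : s ∈ invariantZeros A (inputOp b) C 0) (hsρ : s ∈ resolventSet A) :
    ∃ x, IsNormalizedZero A b s x := by
  obtain ⟨x, u, hx, h1, h2⟩ := hs
  have h1' : s • (x : Z) - A x = u • b := by simpa [inputOp, sub_eq_zero] using h1
  have h3 : inner ℂ b (x : Z) = 0 := by
    have : inner ℂ (inputOp b 1) (x : Z) = 0 := by
      rw [← ContinuousLinearMap.adjoint_inner_right, ← hcol.collocated]
      simpa using h2
    simpa [inputOp] using this
  have hu : u ≠ 0 := by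
    rintro rfl
    rw [zero_smul] at h1'
    exact hx (eq_zero_of_mem_resolventSet hsρ h1')
  refine ⟨u⁻¹ • x, ?_, ?_, ?_⟩
  · simpa [hu] using hx
  · rw [A.map_smul, Submodule.coe_smul, smul_comm, ← smul_sub, h1', inv_smul_smul₀ hu]
  · rw [Submodule.coe_smul, inner_smul_right, h3, mul_zero]

end Complete

end UnboundedOp

theorem mainTheorem5 {Z : Type*} [NormedAddCommGroup Z] [InnerProductSpace ℂ Z] [CompleteSpace Z]
    (A : Z →ₗ.[ℂ] Z) (b : Z) (C : Z →L[ℂ] ℂ)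
    (hb : b ≠ 0)
    (hspec : UnboundedOp.HasDiscreteSpectrum A)
    (hcol : UnboundedOp.IsCollocatedSelfAdjoint A (UnboundedOp.inputOp b) C)
    (hmin : UnboundedOp.IsMinimal A (UnboundedOp.inputOp b) C 0)
    (hneg : UnboundedOp.IsNegSemidef A)
    (hdom : b ∈ UnboundedOp.sqrtDomain (-A)) :
    (UnboundedOp.invariantZeros A (UnboundedOp.inputOp b) C 0).Countable ∧
    ∀ μ : ℕ → ℂ,
      (∀ n, μ n ∈ UnboundedOp.invariantZeros A (UnboundedOp.inputOp b) C 0) →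
      (∀ z : ℂ, {n | μ n = z}.Finite) →
      ∀ ε : ℝ, 0 < ε → ∃ N : ℕ, ∀ n : ℕ, N ≤ n →
        ∃ l : ℂ, UnboundedOp.IsEigenvalue A l ∧ ‖μ n - l‖ < ε := by
  have hA := hcol.isSelfAdjoint
  have hρ : ∀ s ∈ UnboundedOp.invariantZeros A (UnboundedOp.inputOp b) C 0,
      s ∈ UnboundedOp.resolventSet A := by
    intro s hs
    by_contra h
    have : s ∈ UnboundedOp.invariantZeros A (UnboundedOp.inputOp b) C 0 ∩
      UnboundedOp.spectrum A := ⟨hs, h⟩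
    rw [hmin] at this
    exact this
  refine ⟨(UnboundedOp.countable_isNormalizedZero hA b).mono (Set.subset_inter (fun s hs =>
    UnboundedOp.exists_isNormalizedZero hcol hs (hρ s hs)) hρ), ?_⟩
  intro μ hμ hfib ε hε
  have hfin := UnboundedOp.finite_isNormalizedZero hA hb hdom hε
  -- Finitely many far zeros, each taken finitely often, leave finitely many bad indices.
  have hbad := hfin.biUnion (t := fun z => {n | μ n = z}) fun z _ => hfib z
  obtain ⟨N, hN⟩ := hbad.bddAbove
  refine ⟨N + 1, fun n hn => ?_⟩
  by_contra! hfar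
  have hmem : μ n ∈ {s | (∃ x, UnboundedOp.IsNormalizedZero A b s x) ∧
      ∀ l ∈ UnboundedOp.spectrum A, ε ≤ ‖s - l‖} :=
    ⟨UnboundedOp.exists_isNormalizedZero hcol (hμ n) (hρ _ (hμ n)),
      fun l hl => hfar l (hspec.isEigenvalue l hl)⟩
  have := hN (Set.mem_biUnion (t := fun z => {n | μ n = z}) hmem (rfl : μ n = μ n))
  omega
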